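/- A map of sets is called proper if all of its fibres are finite. Two simplices $x, x'$ of a simplicial set $X$ are adjacent if $X(f)(x) = X(f')(x')$ for some arrows $f, f'$ of the simplex category, and $X$ is locally finite if each simplex of $X$ is adjacent to only finitely many nondegenerate simplices. A morphism $Y \to X$ of locally finite simplicial sets is proper if each component map $Y_n \to X_n$ is proper. Write $|X|$ for the geometric realization of $X$. \textbf{Theorem.} (i) If $X$ is a locally finite simplicial set, then $|X|$ is a locally compact Hausdorff space. (ii) If $f : Y \to X$ is a proper morphism between locally finite simplicial sets, then $|f| : |Y| \to |X|$ is a proper continuous map. (iii) Consequently realization yields a functor from the category of locally finite simplicial sets and proper morphisms to the category of locally compact Hausdorff spaces and proper continuous maps; that is, there is a functor between these categories which, composed with the inclusion into topological spaces, equals the usual realization functor restricted to locally finite simplicial sets and proper morphisms. (iv) The source category in (iii) can be considered as a full subcategory of the category of simplicial objects in the category of sets and proper maps: its inclusion into simplicial sets lifts to a fully faithful functor into that category. -/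

import Mathlib

open CategoryTheory

universe u

namespace ProperRealization

/-- Set maps all of whose fibres are finite. -/
def properMapsOfSets : MorphismProperty (Type u) :=
  fun _ T f => ∀ t : T, {s | f s = t}.Finite

instance : properMapsOfSets.{u}.IsMultiplicative where
  id_mem S := fun t => (Set.finite_singleton t).subset fun s hs => by simpa using hs
  comp_mem {R S T} f g hf hg := fun t => by
    refine ((hg t).biUnion fun s _ => hf s).subset fun r hr => ?_
    simp only [Set.mem_iUnion]
    exact ⟨f r, by simpa using hr, rfl⟩

/-- The category of sets and proper set maps. -/
abbrev ProperSet : Type (u + 1) := WideSubcategory properMapsOfSets.{u}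

/-- The inclusion of the category of sets and proper maps into the category of sets. -/
abbrev ProperSet.toType : ProperSet.{u} ⥤ Type u := wideSubcategoryInclusion properMapsOfSets.{u}

/-- Two simplices are adjacent if they have a common image under simplicial operators. -/
def Adjacent {X : SSet.{u}} (x x' : X.S) : Prop :=
  ∃ (k : ℕ) (f : SimplexCategory.mk k ⟶ SimplexCategory.mk x.dim)
      (f' : SimplexCategory.mk k ⟶ SimplexCategory.mk x'.dim),
    X.map f.op x.simplex = X.map f'.op x'.simplex

/-- Simplicial sets each of whose simplices is adjacent to only finitely many nondegenerate
simplices. -/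
def locallyFinite : ObjectProperty SSet.{u} :=
  fun X => ∀ x : X.S, {z : X.N | Adjacent x z.toS}.Finite

/-- Simplicial maps all of whose component set maps are proper. -/
def properSimplicialMaps : MorphismProperty SSet.{u} :=
  fun _ _ f => ∀ n : SimplexCategoryᵒᵖ, properMapsOfSets (f.app n)

instance : properSimplicialMaps.{u}.IsMultiplicative where
  id_mem _ := fun _ => properMapsOfSets.id_mem _
  comp_mem _ _ hf hg := fun n => properMapsOfSets.comp_mem _ _ (hf n) (hg n)

/-- The category of locally finite simplicial sets and proper simplicial maps. -/
abbrev LFSSet : Type (u + 1) :=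
  WideSubcategory (properSimplicialMaps.{u}.inverseImage locallyFinite.{u}.ι)

/-- The inclusion of locally finite simplicial sets and proper maps into simplicial sets. -/
abbrev LFSSet.toSSet : LFSSet.{u} ⥤ SSet.{u} :=
  wideSubcategoryInclusion (properSimplicialMaps.{u}.inverseImage locallyFinite.{u}.ι) ⋙
    locallyFinite.{u}.ι

/-- Locally compact Hausdorff spaces. -/
def locallyCompactHausdorff : ObjectProperty TopCat.{u} :=
  fun X => LocallyCompactSpace X ∧ T2Space X

/-- Proper continuous maps. -/
def properContinuousMaps : MorphismProperty TopCat.{u} :=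
  fun _ _ f => IsProperMap f

instance : properContinuousMaps.{u}.IsMultiplicative where
  id_mem _ := isProperMap_id
  comp_mem f g (hf : IsProperMap f) (hg : IsProperMap g) := by
    simpa [properContinuousMaps] using hg.comp hf

/-- The category of locally compact Hausdorff spaces and proper maps. -/
abbrev PTop : Type (u + 1) :=
  WideSubcategory (properContinuousMaps.{u}.inverseImage locallyCompactHausdorff.{u}.ι)

/-- The inclusion of locally compact Hausdorff spaces and proper maps into spaces. -/
abbrev PTop.toTopCat : PTop.{u} ⥤ TopCat.{u} :=
  wideSubcategoryInclusion
      (properContinuousMaps.{u}.inverseImage locallyCompactHausdorff.{u}.ι) ⋙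
    locallyCompactHausdorff.{u}.ι

end ProperRealization

namespace ProperRealization

open Opposite

/-! A point of an n-simplex cuts [0,1] into intervals with its barycentric coordinates as lengths; a
monotone vertex map merges runs of intervals and may insert empty ones. Given a k-simplex `a` and
functions ψ_0, …, ψ_k varying one after the other, weight each α : [k] → [n] by the product of the
increments of ψ_j over the interval α(j), and sum over the operators α with α^*x = a. Additivity of
increments makes this compatible with simplicial operators, so it descends to |X|
(`exists_samplingFunction`).

Two points of |X| can be written with one common interior point w (`exists_common_refinement`). If
they differ, so do their simplices, and for the ψ_j adapted to w (`clamp`) only α = id has nonzero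
weight; the resulting function separates the points, so |X| is Hausdorff.

For k = 0 and ψ = id one gets vertex coordinates, hence open stars, each inside a closed star that
is compact by local finiteness. This gives local compactness, and properness of |f| follows because
finitely many vertices lie over each vertex. -/

open Finset in
lemma sum_fin_lt_sub {m : ℕ} (h : ℕ → ℝ) {l : ℕ} (hl : l ≤ m) :
    ∑ j : Fin m with j.val < l, (h (j + 1) - h j) = h l - h 0 := by
  induction l with
  | zero => simp
  | succ l ih =>
    have : (univ.filter fun j : Fin m => j.val < l + 1) =
        insert ⟨l, hl⟩ (univ.filter fun j : Fin m => j.val < l) := by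
      ext j
      simp [Fin.ext_iff]
      omega
    rw [this, sum_insert (by simp), ih (by omega)]
    ring

lemma exists_lt_iff_val_lt {m n : ℕ} {θ : Fin m → Fin n} (hθ : Monotone θ) (i : ℕ) :
    ∃ l ≤ m, ∀ j, (θ j).val < i ↔ j.val < l := by
  induction m with
  | zero => exact ⟨0, le_rfl, fun j => j.elim0⟩
  | succ m ih =>
    by_cases h : (θ (Fin.last m)).val < i
    · exact ⟨m + 1, le_rfl, fun j =>
        ⟨fun _ => j.2, fun _ => lt_of_le_of_lt (hθ (Fin.le_last j)) h⟩⟩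
    · obtain ⟨l, hl, hj⟩ := ih (θ := θ ∘ Fin.castSucc) (hθ.comp Fin.strictMono_castSucc.monotone)
      refine ⟨l, by omega, fun j => ?_⟩
      induction j using Fin.lastCases with
      | last => simp only [h, Fin.val_last, false_iff]; omega
      | cast j => exact hj j

/-! ### Partitions of the unit interval and increments -/

/-- The sum of the first `i` barycentric coordinates. -/
noncomputable def cumulative {n : ℕ} (t : stdSimplex ℝ (Fin n)) (i : ℕ) : ℝ :=
  ∑ j : Fin n with j.val < i, t j

lemma cumulative_zero {n : ℕ} (t : stdSimplex ℝ (Fin n)) : cumulative t 0 = 0 := by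
  simp [cumulative]

lemma cumulative_self {n : ℕ} (t : stdSimplex ℝ (Fin n)) : cumulative t n = 1 := by
  simp [cumulative]

lemma cumulative_mono {n : ℕ} (t : stdSimplex ℝ (Fin n)) : Monotone (cumulative t) :=
  fun _ _ h => Finset.sum_le_sum_of_subset_of_nonneg
    (fun k => by simp only [Finset.mem_filter_univ]; omega) fun _ _ _ => t.2.1 _

lemma cumulative_succ {n : ℕ} (t : stdSimplex ℝ (Fin n)) (i : Fin n) :
    cumulative t (i + 1) = cumulative t i + t i := by
  have : (Finset.univ.filter fun j : Fin n => j.val < i + 1) =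
      insert i (Finset.univ.filter fun j : Fin n => j.val < i) := by
    ext j
    simp only [Finset.mem_filter_univ, Finset.mem_insert, Fin.ext_iff]
    omega
  rw [cumulative, this, Finset.sum_insert (by simp), add_comm, cumulative]

lemma continuous_cumulative {n : ℕ} (i : ℕ) :
    Continuous fun t : stdSimplex ℝ (Fin n) => cumulative t i :=
  continuous_finsetSum _ fun j _ => (continuous_apply j).comp continuous_subtype_val

lemma stdSimplex_map_apply {m n : ℕ} (θ : Fin m → Fin n) (s : stdSimplex ℝ (Fin m)) (i : Fin n) :
    stdSimplex.map θ s i = ∑ j with θ j = i, s j := by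
  simp [FunOnFinite.linearMap_apply_apply]

lemma cumulative_map {m n : ℕ} (θ : Fin m → Fin n) (s : stdSimplex ℝ (Fin m)) (i : ℕ) :
    cumulative (stdSimplex.map θ s) i = ∑ j with (θ j).val < i, s j := by
  rw [cumulative, ← Finset.sum_fiberwise_of_maps_to
    (t := Finset.univ.filter fun k : Fin n => k.val < i) (g := θ) (by simp)]
  refine Finset.sum_congr rfl fun k hk => ?_
  rw [stdSimplex_map_apply, Finset.filter_filter]
  refine Finset.sum_congr ?_ fun _ _ => rfl
  ext j
  simp only [Finset.mem_filter_univ] at hk ⊢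
  grind

/-- The increment of `ψ` over the `i`-th interval of the partition of the unit interval given
by the barycentric coordinates. -/
noncomputable def increment {n : ℕ} (ψ : ℝ → ℝ) (t : stdSimplex ℝ (Fin n)) (i : Fin n) : ℝ :=
  ψ (cumulative t (i + 1)) - ψ (cumulative t i)

lemma continuous_increment {n : ℕ} {ψ : ℝ → ℝ} (hψ : Continuous ψ) (i : Fin n) :
    Continuous fun t : stdSimplex ℝ (Fin n) => increment ψ t i :=
  (hψ.comp (continuous_cumulative _)).sub (hψ.comp (continuous_cumulative _))

/-- By monotonicity the indices sent below `i` form an initial segment, over which the increments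
telescope; subtract the sums for `i` and `i + 1`. -/
lemma increment_map {m n : ℕ} (ψ : ℝ → ℝ) {θ : Fin m → Fin n} (hθ : Monotone θ)
    (s : stdSimplex ℝ (Fin m)) (i : Fin n) :
    increment ψ (stdSimplex.map θ s) i = ∑ j with θ j = i, increment ψ s j := by
  have key (i : ℕ) : ∑ j with (θ j).val < i, increment ψ s j =
      ψ (cumulative (stdSimplex.map θ s) i) - ψ 0 := by
    obtain ⟨l, hl, hj⟩ := exists_lt_iff_val_lt hθ i
    simp only [cumulative_map, hj, increment]
    rw [sum_fin_lt_sub (fun k => ψ (cumulative s k)) hl, cumulative_zero]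
    rfl
  have hu : (Finset.univ.filter fun j => (θ j).val < i + 1) =
      (Finset.univ.filter fun j => θ j = i) ∪ (Finset.univ.filter fun j => (θ j).val < i) := by
    ext j
    simp only [Finset.mem_filter_univ, Finset.mem_union, Fin.ext_iff]
    omega
  have h1 := key (i + 1)
  rw [hu, Finset.sum_union, key i] at h1
  · rw [increment]; linarith
  · rw [Finset.disjoint_filter]
    rintro j - rfl
    simp

lemma increment_id {n : ℕ} (t : stdSimplex ℝ (Fin n)) (i : Fin n) : increment id t i = t i := by
  simp [increment, cumulative_succ]

/-- The product of the increments of the functions `ψ j` over the intervals `α j`. -/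
noncomputable def weight {k n : ℕ} (ψ : Fin k → ℝ → ℝ) (t : stdSimplex ℝ (Fin n))
    (α : Fin k → Fin n) : ℝ :=
  ∏ j, increment (ψ j) t (α j)

lemma continuous_weight {k n : ℕ} {ψ : Fin k → ℝ → ℝ} (hψ : ∀ j, Continuous (ψ j))
    (α : Fin k → Fin n) : Continuous fun t : stdSimplex ℝ (Fin n) => weight ψ t α :=
  continuous_finsetProd _ fun j _ => continuous_increment (hψ j) _

lemma weight_map {k m n : ℕ} (ψ : Fin k → ℝ → ℝ) {θ : Fin m → Fin n} (hθ : Monotone θ)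
    (s : stdSimplex ℝ (Fin m)) (α : Fin k → Fin n) :
    weight ψ (stdSimplex.map θ s) α = ∑ β : Fin k → Fin m with θ ∘ β = α, weight ψ s β := by
  simp only [weight, increment_map _ hθ, Finset.prod_univ_sum]
  refine Finset.sum_congr ?_ fun _ _ => rfl
  ext β
  simp [funext_iff]

/-- The functions `ψ i` increase one after the other. -/
def Successive {k : ℕ} (ψ : Fin k → ℝ → ℝ) : Prop :=
  ∀ ⦃i j⦄, i < j → ∀ ⦃a b c d : ℝ⦄, a ≤ b → b ≤ c → c ≤ d → ψ i c = ψ i d ∨ ψ j a = ψ j b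

/-- At an inversion `i < j`, `α j < α i`, either `ψ i` has already stopped on the later interval or
`ψ j` has not started on the earlier one, so a factor vanishes. -/
lemma Successive.weight_eq_zero {k n : ℕ} {ψ : Fin k → ℝ → ℝ} (hψ : Successive ψ)
    (t : stdSimplex ℝ (Fin n)) {α : Fin k → Fin n} (hα : ¬ Monotone α) : weight ψ t α = 0 := by
  obtain ⟨i, j, hij, h⟩ : ∃ i j, i < j ∧ α j < α i := by
    contrapose! hα
    exact monotone_iff_forall_lt.2 fun i j => hα i j
  rw [weight, Finset.prod_eq_zero_iff]
  rcases hψ hij (cumulative_mono t (Nat.le_succ (α j))) (cumulative_mono t (Nat.succ_le_of_lt h))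
    (cumulative_mono t (Nat.le_succ (α i))) with h | h
  · exact ⟨i, Finset.mem_univ _, by rw [increment, ← Nat.succ_eq_add_one, ← h, sub_self]⟩
  · exact ⟨j, Finset.mem_univ _, by rw [increment, ← Nat.succ_eq_add_one, ← h, sub_self]⟩

/-- The retraction of the line onto the `j`-th interval of a partition. -/
noncomputable def clamp {n : ℕ} (w : stdSimplex ℝ (Fin n)) (j : Fin n) (a : ℝ) : ℝ :=
  min (max a (cumulative w j)) (cumulative w (j + 1))

lemma continuous_clamp {n : ℕ} (w : stdSimplex ℝ (Fin n)) (j : Fin n) : Continuous (clamp w j) := by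
  unfold clamp; fun_prop

lemma clamp_of_le {n : ℕ} (w : stdSimplex ℝ (Fin n)) (j : Fin n) {a : ℝ}
    (h : a ≤ cumulative w j) : clamp w j a = cumulative w j := by
  rw [clamp, max_eq_right h, min_eq_left (cumulative_mono w (Nat.le_succ _))]

lemma clamp_of_ge {n : ℕ} (w : stdSimplex ℝ (Fin n)) (j : Fin n) {a : ℝ}
    (h : cumulative w (j + 1) ≤ a) : clamp w j a = cumulative w (j + 1) := by
  rw [clamp, min_eq_right (h.trans (le_max_left _ _))]

lemma successive_clamp {n : ℕ} (w : stdSimplex ℝ (Fin n)) : Successive (clamp w) := by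
  intro i j hij a b c d hab hbc hcd
  rcases le_total (cumulative w (i + 1)) c with h | h
  · left; rw [clamp_of_ge w i h, clamp_of_ge w i (h.trans hcd)]
  · have h' := hbc.trans (h.trans (cumulative_mono w (Nat.succ_le_of_lt hij)))
    right; rw [clamp_of_le w j h', clamp_of_le w j (hab.trans h')]

lemma increment_clamp_self {n : ℕ} (w : stdSimplex ℝ (Fin n)) (j : Fin n) :
    increment (clamp w j) w j = w j := by
  rw [increment, clamp_of_ge w j le_rfl, clamp_of_le w j le_rfl, cumulative_succ]
  ring

lemma increment_clamp_of_ne {n : ℕ} (w : stdSimplex ℝ (Fin n)) {i j : Fin n} (h : i ≠ j) :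
    increment (clamp w j) w i = 0 := by
  rcases lt_or_gt_of_ne h with h | h
  · have h' := cumulative_mono w (Nat.succ_le_of_lt h)
    rw [increment, clamp_of_le w j h', clamp_of_le w j ((cumulative_mono w (Nat.le_succ _)).trans h'),
      sub_self]
  · have h' := cumulative_mono w (Nat.succ_le_of_lt h)
    rw [increment, clamp_of_ge w j h', clamp_of_ge w j (h'.trans (cumulative_mono w (Nat.le_succ _))),
      sub_self]

lemma weight_clamp_id_pos {n : ℕ} (w : stdSimplex ℝ (Fin n)) (hw : ∀ j, 0 < w j) :
    0 < weight (clamp w) w id :=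
  Finset.prod_pos fun j _ => (increment_clamp_self w j).symm ▸ hw j

lemma weight_clamp_of_ne_id {n : ℕ} (w : stdSimplex ℝ (Fin n)) {α : Fin n → Fin n} (hα : α ≠ id) :
    weight (clamp w) w α = 0 := by
  obtain ⟨j, hj⟩ := Function.ne_iff.1 hα
  exact Finset.prod_eq_zero (Finset.mem_univ j) (increment_clamp_of_ne w hj)

/-! ### Common refinement of two partitions -/

lemma stdSimplex_ext_cumulative {n : ℕ} {s t : stdSimplex ℝ (Fin n)}
    (h : ∀ i < n, cumulative s i = cumulative t i) : s = t := by
  have h' (i : ℕ) (hi : i ≤ n) : cumulative s i = cumulative t i := by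
    rcases hi.lt_or_eq with hi | rfl
    · exact h i hi
    · rw [cumulative_self, cumulative_self]
  ext i
  have := h' (i + 1) i.2
  rw [cumulative_succ, cumulative_succ, h i i.2] at this
  exact add_left_cancel this

lemma exists_monotone_map_eq {r n : ℕ} (w : stdSimplex ℝ (Fin r)) (hw : ∀ j, 0 < w j)
    (t : stdSimplex ℝ (Fin (n + 1))) (h : ∀ i ≤ n, ∃ l ≤ r, cumulative t i = cumulative w l) :
    ∃ θ : Fin r → Fin (n + 1), Monotone θ ∧ stdSimplex.map θ w = t := by
  classical
  have hlt (j : Fin r) (l : ℕ) : cumulative w j < cumulative w l ↔ j.val < l := by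
    refine ⟨fun hjl => lt_of_not_ge fun hlj => hjl.not_ge (cumulative_mono w hlj), fun hjl =>
      lt_of_lt_of_le ?_ (cumulative_mono w (Nat.succ_le_of_lt hjl))⟩
    rw [Nat.succ_eq_add_one, cumulative_succ]
    linarith [hw j]
  let P (j : Fin r) (i : ℕ) : Prop := cumulative t i ≤ cumulative w j
  have hP (j : Fin r) (i : ℕ) (hi : i ≤ n) : i ≤ Nat.findGreatest (P j) n ↔ P j i := by
    refine ⟨fun hle => (cumulative_mono t hle).trans
      (Nat.findGreatest_spec (P := P j) (Nat.zero_le n) ?_), Nat.le_findGreatest hi⟩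
    simp only [P, cumulative_zero]
    exact (cumulative_zero w).symm.le.trans (cumulative_mono w (Nat.zero_le _))
  -- Interval `j` of `w` goes to the last interval of `t` starting at or before its left end; taking
  -- the last one skips empty intervals of `t`.
  refine ⟨fun j => ⟨Nat.findGreatest (P j) n, Nat.lt_succ_of_le (Nat.findGreatest_le n)⟩,
    fun j j' hj => Nat.findGreatest_mono_left (fun i hi => hi.trans (cumulative_mono w hj)) n,
    stdSimplex_ext_cumulative fun i hi => ?_⟩
  obtain ⟨l, -, hl⟩ := h i (Nat.le_of_lt_succ hi)
  rw [cumulative_map, hl, cumulative]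
  refine Finset.sum_congr (Finset.filter_congr fun j _ => ?_) fun _ _ => rfl
  rw [← hlt, ← hl, ← not_le, hP j i (Nat.le_of_lt_succ hi), not_le]

/-- Two points of simplices come from an interior point of a common simplex. -/
lemma exists_common_refinement {m n : ℕ} (s : stdSimplex ℝ (Fin (m + 1)))
    (t : stdSimplex ℝ (Fin (n + 1))) :
    ∃ (r : ℕ) (w : stdSimplex ℝ (Fin (r + 1))) (θ : Fin (r + 1) → Fin (m + 1))
      (η : Fin (r + 1) → Fin (n + 1)), (∀ j, 0 < w j) ∧ Monotone θ ∧ Monotone η ∧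
        stdSimplex.map θ w = s ∧ stdSimplex.map η w = t := by
  classical
  -- The breakpoints of both partitions, without repetition: the coordinates of `w` are the gaps
  -- between neighbours, hence positive.
  let C : Finset ℝ := (Finset.range (m + 2)).image (cumulative s) ∪
    (Finset.range (n + 2)).image (cumulative t)
  have hsC (i : ℕ) (hi : i ≤ m + 1) : cumulative s i ∈ C :=
    Finset.mem_union_left _ (Finset.mem_image_of_mem _ (Finset.mem_range.2 (by omega)))
  have htC (i : ℕ) (hi : i ≤ n + 1) : cumulative t i ∈ C :=
    Finset.mem_union_right _ (Finset.mem_image_of_mem _ (Finset.mem_range.2 (by omega)))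
  have h0 : (0 : ℝ) ∈ C := cumulative_zero s ▸ hsC 0 (by omega)
  have h1 : (1 : ℝ) ∈ C := cumulative_self s ▸ hsC (m + 1) le_rfl
  have hC (a : ℝ) (ha : a ∈ C) : 0 ≤ a ∧ a ≤ 1 := by
    simp only [C, Finset.mem_union, Finset.mem_image, Finset.mem_range] at ha
    rcases ha with ⟨i, hi, rfl⟩ | ⟨i, hi, rfl⟩
    · exact ⟨cumulative_zero s ▸ cumulative_mono s (Nat.zero_le i),
        cumulative_self s ▸ cumulative_mono s (by omega)⟩
    · exact ⟨cumulative_zero t ▸ cumulative_mono t (Nat.zero_le i),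
        cumulative_self t ▸ cumulative_mono t (by omega)⟩
  obtain ⟨r, hr⟩ : ∃ r, C.card = r + 2 :=
    ⟨C.card - 2, by have := Finset.one_lt_card.2 ⟨0, h0, 1, h1, zero_ne_one⟩; omega⟩
  let c := C.orderEmbOfFin hr
  have hc (a : ℝ) (ha : a ∈ C) : ∃ i, c i = a := by
    have : a ∈ Set.range c := by rw [Finset.range_orderEmbOfFin]; exact ha
    exact this
  have hc0 : c 0 = 0 := by
    obtain ⟨i, hi⟩ := hc 0 h0
    exact le_antisymm (hi ▸ c.monotone (Fin.zero_le i)) (hC _ (Finset.orderEmbOfFin_mem _ _ _)).1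
  have hc1 : c (Fin.last _) = 1 := by
    obtain ⟨i, hi⟩ := hc 1 h1
    exact le_antisymm (hC _ (Finset.orderEmbOfFin_mem _ _ _)).2 (hi ▸ c.monotone (Fin.le_last i))
  let h (i : ℕ) : ℝ := c (Fin.ofNat (r + 2) i)
  have hh (i : Fin (r + 2)) : h i = c i := by simp [h]
  have hpos (j : Fin (r + 1)) : 0 < h (j + 1) - h j := by
    have h₁ := hh j.succ
    have h₂ := hh j.castSucc
    simp only [Fin.val_succ, Fin.val_castSucc] at h₁ h₂
    rw [h₁, h₂, sub_pos]
    exact c.strictMono (Fin.castSucc_lt_succ)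
  have hsum (l : ℕ) (hl : l ≤ r + 1) :
      ∑ j : Fin (r + 1) with j.val < l, (h (j + 1) - h j) = h l := by
    rw [sum_fin_lt_sub h hl, show h 0 = 0 by simpa [hc0] using hh 0, sub_zero]
  let w : stdSimplex ℝ (Fin (r + 1)) := ⟨fun j => h (j + 1) - h j, fun j => (hpos j).le, by
    have := hsum (r + 1) le_rfl
    simp only [Fin.is_lt, Finset.filter_true] at this
    rw [this]
    exact (hh (Fin.last _)).trans hc1⟩
  have hw (a : ℝ) (ha : a ∈ C) : ∃ l ≤ r + 1, a = cumulative w l := by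
    obtain ⟨i, rfl⟩ := hc a ha
    exact ⟨i, Nat.le_of_lt_succ i.2, (hh i).symm.trans (hsum i (Nat.le_of_lt_succ i.2)).symm⟩
  obtain ⟨θ, hθ, hθs⟩ := exists_monotone_map_eq w hpos s fun i hi => hw _ (hsC i (by omega))
  obtain ⟨η, hη, hηt⟩ := exists_monotone_map_eq w hpos t fun i hi => hw _ (htC i (by omega))
  exact ⟨r, w, θ, η, hpos, hθ, hη, hθs, hηt⟩

/-! ### Points of and maps out of the realization -/

/-- The characteristic map of a simplex in the geometric realization. -/
noncomputable def charMap {X : SSet.{u}} {n : SimplexCategory} (x : X.obj (op n)) :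
    C(stdSimplex ℝ (Fin (n.len + 1)), SSet.toTop.obj X) :=
  (SSet.toTop.map (SSet.yonedaEquiv.symm x)).hom.comp
    ⟨n.toTopHomeo.symm, n.toTopHomeo.symm.continuous⟩

lemma charMap_map {X : SSet.{u}} {m n : SimplexCategory} (f : m ⟶ n) (x : X.obj (op n))
    (t : stdSimplex ℝ (Fin (m.len + 1))) :
    charMap (X.map f.op x) t = charMap x (stdSimplex.map f t) := by
  simp only [charMap, ContinuousMap.comp_apply, ContinuousMap.coe_mk,
    SimplexCategory.toTopHomeo_symm_naturality_apply]
  rw [← SSet.yonedaEquiv_symm_naturality_left, Functor.map_comp]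
  rfl

lemma toTop_map_charMap {X Y : SSet.{u}} (g : Y ⟶ X) {n : SimplexCategory} (y : Y.obj (op n))
    (t : stdSimplex ℝ (Fin (n.len + 1))) :
    SSet.toTop.map g (charMap y t) = charMap (g.app _ y) t := by
  simp only [charMap, ContinuousMap.comp_apply, ContinuousMap.coe_mk]
  rw [← SSet.yonedaEquiv_symm_comp, Functor.map_comp]
  rfl

lemma homEquiv_apply_charMap {X : SSet.{u}} {T : TopCat.{u}} (f : SSet.toTop.obj X ⟶ T)
    {n : SimplexCategory} (x : X.obj (op n)) (t : stdSimplex ℝ (Fin (n.len + 1))) :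
    T.toSSetObjEquiv _ ((sSetTopAdj.homEquiv X T f).app (op n) x) t = f (charMap x t) := by
  rw [Adjunction.homEquiv_unit]
  change (((sSetTopAdj.unit.app X).app (op n) x).down ≫ f).hom ⟨t⟩ = _
  rw [sSetTopAdj_unit_app_app_down]
  rfl

lemma toTop_hom_ext {X : SSet.{u}} {T : TopCat.{u}} {f g : SSet.toTop.obj X ⟶ T}
    (h : ∀ (n : SimplexCategory) (x : X.obj (op n)) (t : stdSimplex ℝ (Fin (n.len + 1))),
      f (charMap x t) = g (charMap x t)) : f = g := by
  apply (sSetTopAdj.homEquiv X T).injective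
  ext ⟨n⟩ x
  apply (T.toSSetObjEquiv _).injective
  ext t
  exact (homEquiv_apply_charMap f x t).trans ((h _ x t).trans (homEquiv_apply_charMap g x t).symm)

/-- A compatible family is a simplicial map to the singular set of `T`; take its adjunct. -/
lemma exists_toTop_hom {X : SSet.{u}} {T : TopCat.{u}}
    (φ : ∀ n : SimplexCategory, X.obj (op n) → C(stdSimplex ℝ (Fin (n.len + 1)), T))
    (hφ : ∀ (m n : SimplexCategory) (f : m ⟶ n) (x : X.obj (op n)) t,
      φ m (X.map f.op x) t = φ n x (stdSimplex.map f t)) :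
    ∃ F : SSet.toTop.obj X ⟶ T, ∀ (n : SimplexCategory) (x : X.obj (op n)) t,
      F (charMap x t) = φ n x t := by
  let G : X ⟶ TopCat.toSSet.obj T :=
    { app n := ↾fun x => (T.toSSetObjEquiv n).symm (φ n.unop x)
      naturality m n f := by
        ext x
        apply (T.toSSetObjEquiv _).injective
        ext t
        exact hφ _ _ f.unop x t }
  refine ⟨(sSetTopAdj.homEquiv X T).symm G, fun n x t => ?_⟩
  rw [← homEquiv_apply_charMap, Equiv.apply_symm_apply]
  exact congr($((T.toSSetObjEquiv _).apply_symm_apply (φ n x)) t)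

lemma exists_realization_continuousMap {X : SSet.{u}}
    (φ : ∀ n : SimplexCategory, X.obj (op n) → C(stdSimplex ℝ (Fin (n.len + 1)), ℝ))
    (hφ : ∀ (m n : SimplexCategory) (f : m ⟶ n) (x : X.obj (op n)) t,
      φ m (X.map f.op x) t = φ n x (stdSimplex.map f t)) :
    ∃ F : C(SSet.toTop.obj X, ℝ), ∀ (n : SimplexCategory) (x : X.obj (op n)) t,
      F (charMap x t) = φ n x t := by
  obtain ⟨F, hF⟩ := exists_toTop_hom (T := TopCat.of (ULift.{u} ℝ))
    (fun n x => ⟨fun t => ⟨φ n x t⟩, continuous_uliftUp.comp (φ n x).continuous⟩)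
    (fun m n f x t => congr(ULift.up $(hφ m n f x t)))
  exact ⟨⟨fun p => (F p).down, continuous_uliftDown.comp F.hom.continuous⟩,
    fun n x t => congr(ULift.down $(hF n x t))⟩

lemma exists_charMap_eq {X : SSet.{u}} (p : SSet.toTop.obj X) :
    ∃ (n : SimplexCategory) (x : X.obj (op n)) (t : stdSimplex ℝ (Fin (n.len + 1))),
      charMap x t = p := by
  -- In the indiscrete topology every predicate is continuous, so "lies in some cell" and "true",
  -- agreeing on all cells, are equal by `toTop_hom_ext`.
  let : TopologicalSpace (ULift.{u} Prop) := ⊤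
  let T : TopCat.{u} := TopCat.of (ULift.{u} Prop)
  let f : SSet.toTop.obj X ⟶ T := TopCat.ofHom
    ⟨fun q => ULift.up (∃ (n : SimplexCategory) (x : X.obj (op n))
      (t : stdSimplex ℝ (Fin (n.len + 1))), charMap x t = q), continuous_top⟩
  let g : SSet.toTop.obj X ⟶ T := TopCat.ofHom ⟨fun _ => ULift.up True, continuous_top⟩
  have h : f = g := toTop_hom_ext fun n x t =>
    congrArg ULift.up (eq_true ⟨n, x, t, rfl⟩)
  exact of_eq_true congr(ULift.down ($h p))

/-! ### Sampling functions and the Hausdorff property -/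

open Classical in
/-- The coefficient of `α` in the sampling function of the simplex `a`. -/
noncomputable def coefficient {X : SSet.{u}} {k n : SimplexCategory} (a : X.obj (op k))
    (x : X.obj (op n)) (α : Fin (k.len + 1) → Fin (n.len + 1)) : ℝ :=
  if ∃ f : k ⟶ n, ⇑f = α ∧ X.map f.op x = a then 1 else 0

lemma coefficient_nonneg {X : SSet.{u}} {k n : SimplexCategory} (a : X.obj (op k))
    (x : X.obj (op n)) (α : Fin (k.len + 1) → Fin (n.len + 1)) : 0 ≤ coefficient a x α := by
  unfold coefficient; split_ifs <;> simp

lemma coefficient_coe {X : SSet.{u}} {k n : SimplexCategory} (a : X.obj (op k))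
    (x : X.obj (op n)) (f : k ⟶ n) [Decidable (X.map f.op x = a)] :
    coefficient a x f = if X.map f.op x = a then 1 else 0 := by
  unfold coefficient
  congr 1
  refine propext ⟨?_, fun h => ⟨f, rfl, h⟩⟩
  rintro ⟨g, hg, h⟩
  obtain rfl : g = f := ConcreteCategory.hom_ext _ _ fun i => congrFun hg i
  exact h

lemma coefficient_map {X : SSet.{u}} {k m n : SimplexCategory} (a : X.obj (op k))
    (x : X.obj (op n)) (θ : m ⟶ n) {β : Fin (k.len + 1) → Fin (m.len + 1)} (hβ : Monotone β) :
    coefficient a (X.map θ.op x) β = coefficient a x (θ ∘ β) := by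
  classical
  let f : k ⟶ m := SimplexCategory.Hom.mk ⟨β, hβ⟩
  have h₁ := coefficient_coe a (X.map θ.op x) f
  have h₂ := coefficient_coe a x (f ≫ θ)
  rw [op_comp, Functor.map_comp_apply] at h₂
  exact h₁.trans h₂.symm

/-- The realization carries, for every simplex `a`, a continuous function measuring how often
sampling a point yields `a`. -/
lemma exists_samplingFunction (X : SSet.{u}) {k : SimplexCategory} (a : X.obj (op k))
    {ψ : Fin (k.len + 1) → ℝ → ℝ} (hψ : ∀ j, Continuous (ψ j)) (hψ' : Successive ψ) :
    ∃ F : C(SSet.toTop.obj X, ℝ), ∀ (n : SimplexCategory) (x : X.obj (op n)) t,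
      F (charMap x t) = ∑ α, coefficient a x α * weight ψ t α := by
  refine exists_realization_continuousMap (fun n x => ⟨fun t =>
    ∑ α, coefficient a x α * weight ψ t α, continuous_finsetSum _ fun α _ =>
      continuous_const.mul (continuous_weight hψ α)⟩) fun m n f x t => ?_
  have hf : Monotone f := f.toOrderHom.monotone
  simp only [ContinuousMap.coe_mk, weight_map ψ hf, Finset.mul_sum]
  rw [← Finset.sum_fiberwise Finset.univ (fun β : Fin (k.len + 1) → Fin (m.len + 1) => f ∘ β)]
  refine Finset.sum_congr rfl fun α _ => Finset.sum_congr rfl fun β hβ => ?_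
  -- For non-monotone `β` the two coefficients may differ, as `θ ∘ β` can be monotone for the
  -- operator `θ = f`; the weight then vanishes.
  by_cases hm : Monotone β
  · rw [coefficient_map a x f hm, (Finset.mem_filter.1 hβ).2]
  · rw [hψ'.weight_eq_zero t hm, mul_zero, mul_zero]

lemma exists_continuousMap_ne {X : SSet.{u}} {p q : SSet.toTop.obj X} (hpq : p ≠ q) :
    ∃ F : C(SSet.toTop.obj X, ℝ), F p ≠ F q := by
  classical
  obtain ⟨m, x, s, rfl⟩ := exists_charMap_eq p
  obtain ⟨n, y, t, rfl⟩ := exists_charMap_eq q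
  obtain ⟨r, w, θ, η, hw, hθ, hη, rfl, rfl⟩ := exists_common_refinement s t
  let f : SimplexCategory.mk r ⟶ m := SimplexCategory.Hom.mk ⟨θ, hθ⟩
  let g : SimplexCategory.mk r ⟶ n := SimplexCategory.Hom.mk ⟨η, hη⟩
  have hf : charMap (X.map f.op x) w = charMap x (stdSimplex.map θ w) := charMap_map f x w
  have hg : charMap (X.map g.op y) w = charMap y (stdSimplex.map η w) := charMap_map g y w
  rw [← hf, ← hg] at hpq ⊢
  obtain ⟨F, hF⟩ := exists_samplingFunction X (X.map f.op x) (continuous_clamp w)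
    (successive_clamp w)
  -- At `w` only the identity has nonzero weight, so `F` tests whether `z` is the sampled simplex.
  have key (z : X.obj (op (SimplexCategory.mk r))) : F (charMap z w) =
      if z = X.map f.op x then weight (clamp w) w id else 0 := by
    rw [hF, Finset.sum_eq_single id (fun α _ hα => by rw [weight_clamp_of_ne_id w hα, mul_zero])
      (by simp)]
    have := coefficient_coe (X.map f.op x) z (𝟙 (SimplexCategory.mk r))
    rw [op_id, Functor.map_id_apply] at this
    rw [show coefficient (X.map f.op x) z id = _ from this, ite_mul, one_mul, zero_mul]
  refine ⟨F, ?_⟩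
  rw [key, key, if_pos rfl, if_neg fun h => hpq (by rw [h])]
  exact (weight_clamp_id_pos w hw).ne'

instance t2Space_toTop_obj (X : SSet.{u}) : T2Space (SSet.toTop.obj X) where
  t2 _ _ hpq := by
    obtain ⟨F, hF⟩ := exists_continuousMap_ne hpq
    exact separated_by_continuous F.continuous hF

/-! ### Stars of vertices, local compactness and properness -/

/-- The union of the closed cells meeting a vertex. -/
def closedStar {X : SSet.{u}} (v : X.obj (op (SimplexCategory.mk 0))) : Set (SSet.toTop.obj X) :=
  ⋃ z ∈ {z : X.N | Adjacent (SSet.S.mk v) z.toS}, Set.range (charMap z.simplex)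

lemma isCompact_closedStar {X : SSet.{u}} (hX : locallyFinite X)
    (v : X.obj (op (SimplexCategory.mk 0))) :
    IsCompact (closedStar v) :=
  (hX _).isCompact_biUnion fun _ _ => isCompact_range (charMap _).continuous

/-- The nondegenerate simplex of which `x` is a degeneracy has the same vertex, and its cell
contains the point. -/
lemma charMap_mem_closedStar {X : SSet.{u}} {n : SimplexCategory} (x : X.obj (op n))
    (f : SimplexCategory.mk 0 ⟶ n) (t : stdSimplex ℝ (Fin (n.len + 1))) :
    charMap x t ∈ closedStar (X.map f.op x) := by
  obtain ⟨m, g, -, z, rfl⟩ := SSet.exists_nonDegenerate (n := n.len) X x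
  refine Set.mem_biUnion (x := SSet.N.mk _ z.2) ⟨0, 𝟙 _, f ≫ g, ?_⟩ ⟨stdSimplex.map g t, ?_⟩
  · change X.map (𝟙 _) (X.map f.op (X.map g.op z.1)) = X.map (f ≫ g).op z.1
    rw [op_comp, Functor.map_comp_apply, Functor.map_id_apply]
  · exact (charMap_map g z.1 t).symm

/-- The barycentric coordinate of a vertex, as a function on the realization. -/
lemma exists_vertexCoordinate (X : SSet.{u}) (v : X.obj (op (SimplexCategory.mk 0))) :
    ∃ F : C(SSet.toTop.obj X, ℝ), ∀ (n : SimplexCategory) (x : X.obj (op n)) t,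
      0 < F (charMap x t) ↔ ∃ f : SimplexCategory.mk 0 ⟶ n, X.map f.op x = v ∧ 0 < t (f 0) := by
  classical
  -- This `F` adds up the coordinates at all vertices of `x` equal to `v`.
  obtain ⟨F, hF⟩ := exists_samplingFunction X v (ψ := fun _ => id) (fun _ => continuous_id)
    (fun i j hij => absurd hij (by rw [Subsingleton.elim (α := Fin 1) i j]; exact lt_irrefl _))
  refine ⟨F, fun n x t => ?_⟩
  have hw (α : Fin 1 → Fin (n.len + 1)) : weight (fun _ => id) t α = t (α 0) := by
    simp [weight, increment_id]
  rw [hF, Finset.sum_pos_iff_of_nonneg fun α _ => mul_nonneg (coefficient_nonneg v x α)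
    ((hw α).symm ▸ t.2.1 _)]
  constructor
  · rintro ⟨α, -, h⟩
    rw [show weight _ t α = _ from hw α] at h
    by_cases hc : ∃ f : SimplexCategory.mk 0 ⟶ n, ⇑f = α ∧ X.map f.op x = v
    · obtain ⟨f, rfl, hf⟩ := hc
      exact ⟨f, hf, pos_of_mul_pos_right h (coefficient_nonneg _ _ _)⟩
    · rw [coefficient, if_neg hc, zero_mul] at h
      exact absurd h (lt_irrefl _)
  · rintro ⟨f, hf, h⟩
    refine ⟨f, Finset.mem_univ _, ?_⟩
    rw [show weight _ t f = _ from hw f, coefficient_coe, if_pos hf, one_mul]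
    exact h

lemma exists_vertex_pos {X : SSet.{u}} (p : SSet.toTop.obj X) :
    ∃ (n : SimplexCategory) (x : X.obj (op n)) (t : stdSimplex ℝ (Fin (n.len + 1)))
      (f : SimplexCategory.mk 0 ⟶ n), charMap x t = p ∧ 0 < t (f 0) := by
  obtain ⟨n, x, t, rfl⟩ := exists_charMap_eq p
  obtain ⟨i, hi⟩ : ∃ i, 0 < t i := by
    by_contra! h
    have := t.2.2
    exact absurd (Finset.sum_nonpos fun i _ => h i) (by rw [show ∑ i, t i = 1 from this]; norm_num)
  exact ⟨n, x, t, SimplexCategory.const _ _ i, rfl, hi⟩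

/-- The open star of a vertex. -/
lemma exists_openStar (X : SSet.{u}) (v : X.obj (op (SimplexCategory.mk 0))) :
    ∃ U : Set (SSet.toTop.obj X), IsOpen U ∧
      ∀ (n : SimplexCategory) (x : X.obj (op n)) t, charMap x t ∈ U ↔
        ∃ f : SimplexCategory.mk 0 ⟶ n, X.map f.op x = v ∧ 0 < t (f 0) := by
  obtain ⟨F, hF⟩ := exists_vertexCoordinate X v
  exact ⟨{p | 0 < F p}, isOpen_lt continuous_const F.continuous, hF⟩

lemma weaklyLocallyCompactSpace_realization {X : SSet.{u}} (hX : locallyFinite X) :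
    WeaklyLocallyCompactSpace (SSet.toTop.obj X) where
  exists_compact_mem_nhds p := by
    obtain ⟨n, x, t, f, rfl, ht⟩ := exists_vertex_pos p
    obtain ⟨U, hU, hU'⟩ := exists_openStar X (X.map f.op x)
    refine ⟨_, isCompact_closedStar hX (X.map f.op x), Filter.mem_of_superset
      (hU.mem_nhds ((hU' n x t).2 ⟨f, rfl, ht⟩)) fun q hq => ?_⟩
    obtain ⟨m, y, s, rfl⟩ := exists_charMap_eq q
    obtain ⟨g, hg, -⟩ := (hU' m y s).1 hq
    exact hg ▸ charMap_mem_closedStar y g s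

/-- Finitely many open stars cover a compact `K`; its preimage is closed and lies in the closed
stars of the finitely many vertices of `Y` above their centres. -/
lemma isProperMap_toTop_map {X Y : SSet.{u}} (f : Y ⟶ X) (hY : locallyFinite Y)
    (hX : locallyFinite X) (hf : properSimplicialMaps f) : IsProperMap (SSet.toTop.map f) := by
  have := weaklyLocallyCompactSpace_realization hX
  rw [isProperMap_iff_isCompact_preimage]
  refine ⟨(SSet.toTop.map f).hom.continuous, fun K hK => ?_⟩
  choose U hU hU' using exists_openStar X
  obtain ⟨S, hS⟩ := hK.elim_finite_subcover U hU fun p _ => by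
    obtain ⟨n, x, t, g, rfl, ht⟩ := exists_vertex_pos p
    exact Set.mem_iUnion.2 ⟨_, (hU' _ n x t).2 ⟨g, rfl, ht⟩⟩
  refine IsCompact.of_isClosed_subset (S.finite_toSet.isCompact_biUnion fun v _ =>
    (hf (op (SimplexCategory.mk 0)) v).isCompact_biUnion fun w _ => isCompact_closedStar hY w)
    (hK.isClosed.preimage (SSet.toTop.map f).hom.continuous) fun q hq => ?_
  obtain ⟨n, y, t, rfl⟩ := exists_charMap_eq q
  obtain ⟨v, hv, hq⟩ := Set.mem_iUnion₂.1 (hS hq)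
  rw [toTop_map_charMap, hU'] at hq
  obtain ⟨g, hg, -⟩ := hq
  refine Set.mem_biUnion hv (Set.mem_biUnion (x := Y.map g.op y) ?_ (charMap_mem_closedStar y g t))
  exact (NatTrans.naturality_apply f g.op y).trans hg

lemma locallyCompactHausdorff_toTop_obj {X : SSet.{u}} (hX : locallyFinite X) :
    locallyCompactHausdorff (SSet.toTop.obj X) :=
  have := weaklyLocallyCompactSpace_realization hX
  ⟨inferInstance, inferInstance⟩

/-! ### The two functors -/

/-- Geometric realization of locally finite simplicial sets and proper maps. -/
noncomputable def LFSSet.toPTop : LFSSet.{u} ⥤ PTop.{u} where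
  obj X := ⟨⟨SSet.toTop.obj X.obj.obj, locallyCompactHausdorff_toTop_obj X.obj.property⟩⟩
  map {Y X} f := ⟨ObjectProperty.homMk (SSet.toTop.map f.hom.hom),
    isProperMap_toTop_map f.hom.hom Y.obj.property X.obj.property f.property⟩
  map_id X := by
    ext : 2
    exact SSet.toTop.map_id X.obj.obj
  map_comp f g := by
    ext : 2
    exact SSet.toTop.map_comp f.hom.hom g.hom.hom

/-- The simplicial operators of a locally finite simplicial set are proper. -/
lemma properMapsOfSets_map {X : SSet.{u}} (hX : locallyFinite X) {m n : SimplexCategoryᵒᵖ}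
    (f : m ⟶ n) : properMapsOfSets (X.map f) := by
  intro y
  have (k : SimplexCategory) : Finite (m.unop ⟶ k) :=
    Finite.of_injective (fun g : m.unop ⟶ k => (⇑g : _ → _)) fun g h e =>
      ConcreteCategory.hom_ext _ _ fun i => congrFun e i
  -- Each `x` over `y` is the image, under one of finitely many operators, of a nondegenerate `z`
  -- adjacent to `y`; there are finitely many such `z`.
  refine ((hX (SSet.S.mk (dim := n.unop.len) y)).biUnion fun z _ =>
    Set.finite_range fun g : m.unop ⟶ SimplexCategory.mk z.dim => X.map g.op z.simplex).subset
      fun x hx => ?_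
  obtain ⟨k, g, -, z, hz⟩ := SSet.exists_nonDegenerate (n := m.unop.len) X x
  refine Set.mem_biUnion (x := SSet.N.mk _ z.2) ⟨n.unop.len, 𝟙 _, f.unop ≫ g, ?_⟩ ⟨g, hz.symm⟩
  have hx' : X.map f x = y := hx
  change X.map (𝟙 _) y = X.map (f.unop ≫ g).op z.1
  rw [op_comp, Functor.map_comp_apply, Functor.map_id_apply, ← hx', hz]
  rfl

/-- A locally finite simplicial set as a simplicial object in sets and proper maps. -/
def LFSSet.toSimplicialProperSet : LFSSet.{u} ⥤ SimplicialObject ProperSet.{u} where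
  obj X :=
    { obj n := ⟨X.obj.obj.obj n⟩
      map f := ⟨X.obj.obj.map f, properMapsOfSets_map X.obj.property f⟩
      map_id n := by
        ext : 1
        exact X.obj.obj.map_id n
      map_comp f g := by
        ext : 1
        exact X.obj.obj.map_comp f g }
  map f :=
    { app n := ⟨f.hom.hom.app n, f.property n⟩
      naturality m n g := by
        ext : 1
        exact f.hom.hom.naturality g }
  map_id _ := rfl
  map_comp _ _ := rfl

instance : LFSSet.toSimplicialProperSet.{u}.Faithful where
  map_injective h := by
    ext : 3
    exact congr(InducedWideCategory.Hom.hom (NatTrans.app $h _))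

instance : LFSSet.toSimplicialProperSet.{u}.Full where
  map_surjective φ :=
    ⟨⟨ObjectProperty.homMk
      { app n := (φ.app n).hom
        naturality _ _ g := congr(InducedWideCategory.Hom.hom $(φ.naturality g)) },
      fun n => (φ.app n).property⟩, rfl⟩

end ProperRealization

theorem mainTheorem2 :
    -- the realization of a locally finite simplicial set is locally compact Hausdorff
    (∀ X : SSet.{u}, ProperRealization.locallyFinite X →
      LocallyCompactSpace (SSet.toTop.obj X) ∧ T2Space (SSet.toTop.obj X)) ∧
    -- a proper morphism of locally finite simplicial sets realizes to a proper map
    (∀ (Y X : SSet.{u}) (f : Y ⟶ X), ProperRealization.locallyFinite Y →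
      ProperRealization.locallyFinite X → ProperRealization.properSimplicialMaps f →
      IsProperMap (SSet.toTop.map f)) ∧
    -- realization restricts to a functor between the categories of proper maps
    (∃ F : ProperRealization.LFSSet.{u} ⥤ ProperRealization.PTop.{u},
      F ⋙ ProperRealization.PTop.toTopCat =
        ProperRealization.LFSSet.toSSet ⋙ SSet.toTop.{u}) ∧
    -- its source is a full subcategory of the simplicial objects in sets and proper maps
    (∃ G : ProperRealization.LFSSet.{u} ⥤ SimplicialObject ProperRealization.ProperSet.{u},
      G ⋙ (SimplicialObject.whiskering _ _).obj ProperRealization.ProperSet.toType =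
        ProperRealization.LFSSet.toSSet ∧
      G.Full ∧ G.Faithful) :=
  ⟨fun _ hX => ProperRealization.locallyCompactHausdorff_toTop_obj hX,
    fun _ _ f => ProperRealization.isProperMap_toTop_map f,
    ⟨ProperRealization.LFSSet.toPTop, rfl⟩,
    ⟨ProperRealization.LFSSet.toSimplicialProperSet, rfl, inferInstance, inferInstance⟩⟩
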